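/- **Setting.** A Cell Transmission Model (CTM) traffic network is a directed graph whose edges are the cells $1,\dots,n$; every junction that has both incoming and outgoing cells is ordinary (one in, one out), a diverge (one in, several out) or a merge (several in, one out). Cell $j$ is an out-neighbour of cell $i$ (and $i$ an in-neighbour of $j$) if the downstream junction of $i$ is the upstream junction of $j$. Given are a set $\mathcal E_{\rm on}$ of cells without in-neighbours (on-ramps) and a set $\mathcal E_{\rm off}$ of cells without out-neighbours (off-ramps). Let $T_s>0$ be the sampling period, and let cell $i$ have length $\ell_i>0$, free-flow speed $v_i>0$, congestion wave speed $w_i>0$, capacity $C_i\ge 0$ and jam density $\gamma_i\in(0,\infty]$. The (possibly time-dependent) split ratios satisfy $R^k_{ij}\in[0,1]$, $R^k_{ij}=0$ if $j=i$ or if $j$ is not an out-neighbour of $i$, and $\sum_jR^k_{ij}=1$ for $i\notin\mathcal E_{\rm off}$. The exogenous inflows $\lambda^k_i\in\mathbb R$ are known, with $\lambda^k_i=0$ for $i\notin\mathcal E_{\rm on}$. With traffic masses $x^k\in\mathbb R^n$ and outflow rates (controls) $u^k\in\mathbb R^n$ the dynamics and constraints are, for all $i$, $$x_i^{k+1}=x_i^k+T_s(y_i^k-u_i^k),\qquad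 y_i^k=\lambda_i^k+\sum_{j}R^k_{ji}u_j^k,$$ $$0\le u_i^k\le\min\{(v_i/\ell_i)x_i^k,\,C_i\},\qquad 0\le y_i^k\le\min\{w_i(\gamma_i-x_i^k/\ell_i),\,C_i\}$$ (only $0\le y_i^k\le C_i$ if $\gamma_i=\infty$). For a horizon $N$, weights $\alpha_i^k,\beta_i^k\in\mathbb R$ and $0\le k<N$, let problem $\mathcal P_k(x)$ be the minimization of $$J^{[k,N]}=\sum_i\alpha_i^Nx_i^N+\sum_{t=k}^{N-1}\sum_i(\alpha_i^tx_i^t+\beta_i^tu_i^t)$$ over the sequences $(x^t),(u^t)$ that satisfy the dynamics and constraints at the times $t=k,\dots,N-1$ and $x^k=x$. Let $X^k\subseteq\mathbb R^n$ be the set of feasible states at time $k$, i.e. of the $x$ for which $\mathcal P_k(x)$ is feasible. **Theorem.** There are $N$ multi-parametric linear programs, one for each $k=0,\dots,N-1$, $$\min_z\; c_k^\top z\quad\text{s.t.}\quad W_kz\le G_k+S_k\theta,$$ with data that do not depend on the states (but may depend on $\lambda$), such that: 1. The $k$-th program is $\mathcal P_k(\theta)$ in the decision vector $z=(u^k,\dots,u^{N-1})$: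 for all $\theta$ and $z$, $z$ is feasible in the program exactly if the control sequence $z$ is admissible from $x^k=\theta$, and $J^{[k,N]}=c_k^\top z+g_k(\theta)$ for a function $g_k$ of $\theta$ alone. 2. Each program has an optimizer $z_k^*(\theta)$ that is continuous on the set of its feasible parameters and piecewise affine on a polyhedral partition of that set. 3. Let $z_k^*$, $0\le k<N$, be any such continuous piecewise affine optimizers, and let $\phi^k(x)$ be the first block (the component $u^k$) of $z_k^*(x)$. Then $\phi^k$ is a continuous piecewise affine static feedback law $$\phi^k(x)=F_i^kx+f_i^k\quad\text{if } x\in\mathcal R_i^k=\{x\in\mathbb R^n: H_i^kx\le h_i^k\},\qquad i=1,\dots,p^k,$$ where $\mathcal R_1^k,\dots,\mathcal R_{p^k}^k$ are the polyhedra of the partition for $z_k^*$ and form a polyhedral partition of $X^k$, and $F_i^k,f_i^k$ are the rows belonging to time $k$ of the matrices and vectors in the affine pieces of $z_k^*$. The feedback $u^k=\phi^k(x^k)$ is optimal: for every $j<N$ and every $x\in X^j$ (in particular for $j=0$ and every feasible initial state), the closed-loop trajectory $x^j=x$, $u^k=\phi^k(x^k)$, $k=j,\dots,N-1$, satisfies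 all constraints and attains the minimum in $\mathcal P_j(x)$. Here finitely many polyhedra form a polyhedral partition of a set if they are nonempty, their union is the set, and their relative interiors are pairwise disjoint. -/

import Mathlib

noncomputable section

/-! ### Piecewise affine maps and multi-parametric linear programs -/

/-- The data of finitely many affine maps `x ↦ F i x + f i` attached to convex polyhedra
`{x | H i x ≤ h i}`. -/
structure PWAData (ι κ : Type*) where
  /-- number of pieces -/
  count : ℕ
  /-- number of inequalities that describe the `i`-th polyhedron -/
  rows : Fin count → ℕ
  H : (i : Fin count) → Matrix (Fin (rows i)) ι ℝ
  h : (i : Fin count) → Fin (rows i) → ℝ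
  F : Fin count → Matrix κ ι ℝ
  f : Fin count → κ → ℝ

/-- The `i`-th polyhedron `{x | H i x ≤ h i}`. -/
def PWAData.region {ι κ : Type*} [Fintype ι] (A : PWAData ι κ) (i : Fin A.count) :
    Set (ι → ℝ) :=
  {x | (A.H i).mulVec x ≤ A.h i}

/-- `φ` is, on `D`, the continuous piecewise affine function with data `A`: the polyhedra of `A`
form a polyhedral partition of `D` (they are nonempty, they cover exactly `D`, and their relative
interiors are pairwise disjoint), `φ` is given on each of them by the corresponding affine map,
and `φ` is continuous on `D`. -/
structure IsContinuousPWAOn {ι κ : Type*} [Fintype ι] (A : PWAData ι κ) (D : Set (ι → ℝ))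
    (φ : (ι → ℝ) → (κ → ℝ)) : Prop where
  region_nonempty : ∀ i, (A.region i).Nonempty
  iUnion_region : ⋃ i, A.region i = D
  disjoint_interior : ∀ i j, i ≠ j →
    Disjoint (intrinsicInterior ℝ (A.region i)) (intrinsicInterior ℝ (A.region j))
  eq_affine : ∀ i, ∀ x ∈ A.region i, φ x = (A.F i).mulVec x + A.f i
  continuousOn : ContinuousOn φ D

/-- The multi-parametric linear program
`min c ⬝ z` subject to `W z ≤ G + S θ`, with decision vector `z` and parameter vector `θ`. -/
structure MPLP (κ ι : Type*) where
  rows : ℕ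
  c : κ → ℝ
  W : Matrix (Fin rows) κ ℝ
  G : Fin rows → ℝ
  S : Matrix (Fin rows) ι ℝ

namespace MPLP

variable {κ ι : Type*} [Fintype κ] [Fintype ι]

/-- The feasible decision vectors for the parameter `θ`. -/
def feasible (P : MPLP κ ι) (θ : ι → ℝ) : Set (κ → ℝ) :=
  {z | P.W.mulVec z ≤ P.G + P.S.mulVec θ}

/-- The parameters for which the program is feasible. -/
def feasibleParams (P : MPLP κ ι) : Set (ι → ℝ) :=
  {θ | (P.feasible θ).Nonempty}

/-- `z` is an optimizer for the parameter `θ`. -/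
def IsOptimizer (P : MPLP κ ι) (θ : ι → ℝ) (z : κ → ℝ) : Prop :=
  z ∈ P.feasible θ ∧ ∀ z' ∈ P.feasible θ, P.c ⬝ᵥ z ≤ P.c ⬝ᵥ z'

/-- `zs` is an optimizer function of the program that is continuous and piecewise affine, with
data `A`, on the set of feasible parameters. -/
structure IsPWASolution (P : MPLP κ ι) (A : PWAData ι κ) (zs : (ι → ℝ) → (κ → ℝ)) : Prop where
  isOptimizer : ∀ θ ∈ P.feasibleParams, P.IsOptimizer θ (zs θ)
  isContinuousPWAOn : IsContinuousPWAOn A P.feasibleParams zs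

end MPLP

/-! ### Traffic networks -/

/-- A traffic network of the Cell Transmission Model with `n` cells, which are the edges of a
directed graph with set of junctions `V`, and affine demand and supply functions. -/
structure CTMNetwork (n : ℕ) (V : Type*) where
  /-- upstream junction of a cell -/
  tail : Fin n → V
  /-- downstream junction of a cell -/
  head : Fin n → V
  /-- A junction with incoming and outgoing cells is ordinary (one incoming and one outgoing
  cell), a diverge (one incoming and several outgoing cells), or a merge (several incoming cells
  and one outgoing cell). -/
  junction_type : ∀ a : V, (∃ i, head i = a) → (∃ j, tail j = a) →
    ({i | head i = a}.ncard = 1 ∧ {j | tail j = a}.ncard = 1) ∨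
    ({i | head i = a}.ncard = 1 ∧ 2 ≤ {j | tail j = a}.ncard) ∨
    (2 ≤ {i | head i = a}.ncard ∧ {j | tail j = a}.ncard = 1)
  onRamps : Set (Fin n)
  offRamps : Set (Fin n)
  /-- an on-ramp has no in-neighbours -/
  onRamps_inNeighbors : ∀ i ∈ onRamps, ∀ j, head j ≠ tail i
  /-- an off-ramp has no out-neighbours -/
  offRamps_outNeighbors : ∀ i ∈ offRamps, ∀ j, tail j ≠ head i
  /-- sampling period -/
  Ts : ℝ
  Ts_pos : 0 < Ts
  /-- length of a cell -/
  len : Fin n → ℝ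
  len_pos : ∀ i, 0 < len i
  /-- free-flow speed -/
  v : Fin n → ℝ
  v_pos : ∀ i, 0 < v i
  /-- backward congestion wave speed -/
  w : Fin n → ℝ
  w_pos : ∀ i, 0 < w i
  /-- flow capacity -/
  C : Fin n → ℝ
  C_nonneg : ∀ i, 0 ≤ C i
  /-- jam density; the value `⊤` (as is usual for on-ramps) is allowed -/
  γ : Fin n → WithTop ℝ
  γ_pos : ∀ i, 0 < γ i
  /-- `R k i j` is the fraction of the flow leaving cell `i` at time `k` that enters cell `j` -/
  R : ℕ → Fin n → Fin n → ℝ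
  R_nonneg : ∀ k i j, 0 ≤ R k i j
  R_le_one : ∀ k i j, R k i j ≤ 1
  R_sum : ∀ k, ∀ i ∉ offRamps, ∑ j, R k i j = 1
  R_eq_zero : ∀ k i j, j = i ∨ tail j ≠ head i → R k i j = 0

namespace CTMNetwork

variable {n : ℕ} {V : Type*}

/-- The total inflow rates `y` at time `k`, for exogenous inflow rates `lam` and outflow
rates `u`. -/
def inflow (net : CTMNetwork n V) (lam : ℕ → Fin n → ℝ) (k : ℕ) (u : Fin n → ℝ) : Fin n → ℝ :=
  fun i => lam k i + ∑ j, net.R k j i * u j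

/-- The traffic masses at time `k + 1`, from the traffic masses `x` and the outflow rates `u` at
time `k`. -/
def step (net : CTMNetwork n V) (lam : ℕ → Fin n → ℝ) (k : ℕ) (x u : Fin n → ℝ) : Fin n → ℝ :=
  fun i => x i + net.Ts * (net.inflow lam k u i - u i)

/-- The maximal outflow rate of cell `i` at traffic mass `ξ`. -/
def demand (net : CTMNetwork n V) (i : Fin n) (ξ : ℝ) : ℝ :=
  min (net.v i / net.len i * ξ) (net.C i)

/-- The maximal inflow rate of cell `i` at traffic mass `ξ`; for an infinite jam density only
the capacity bound remains. -/
def supply (net : CTMNetwork n V) (i : Fin n) (ξ : ℝ) : ℝ :=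
  match net.γ i with
  | none => net.C i
  | some g => min (net.w i * (g - 1 / net.len i * ξ)) (net.C i)

/-- The state sequence `x` and the control sequence `u` satisfy the dynamics and the
demand/supply constraints of the network at the times `j, …, N - 1`. -/
def IsAdmissible (net : CTMNetwork n V) (lam : ℕ → Fin n → ℝ) (j N : ℕ)
    (x u : ℕ → Fin n → ℝ) : Prop :=
  ∀ k, j ≤ k → k < N →
    x (k + 1) = net.step lam k (x k) (u k) ∧
    ∀ i, (0 ≤ u k i ∧ u k i ≤ net.demand i (x k i)) ∧
      (0 ≤ net.inflow lam k (u k) i ∧ net.inflow lam k (u k) i ≤ net.supply i (x k i))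

/-- The feasible states at time `j`: those from which the constraints can be met up to the
end of the horizon. -/
def feasibleStates (net : CTMNetwork n V) (lam : ℕ → Fin n → ℝ) (j N : ℕ) : Set (Fin n → ℝ) :=
  {ξ | ∃ x u : ℕ → Fin n → ℝ, x j = ξ ∧ net.IsAdmissible lam j N x u}

/-- The linear cost over the horizon `[j, N]`, with weights `α`, `β`. -/
def cost (α β : ℕ → Fin n → ℝ) (j N : ℕ) (x u : ℕ → Fin n → ℝ) : ℝ :=
  ∑ i, α N i * x N i + ∑ k ∈ Finset.Ico j N, ∑ i, (α k i * x k i + β k i * u k i)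

/-- `(x, u)` solves the optimal control problem over `[j, N]` with state `ξ` at time `j`. -/
def IsOptimal (net : CTMNetwork n V) (lam α β : ℕ → Fin n → ℝ) (j N : ℕ) (ξ : Fin n → ℝ)
    (x u : ℕ → Fin n → ℝ) : Prop :=
  (x j = ξ ∧ net.IsAdmissible lam j N x u) ∧
    ∀ x' u' : ℕ → Fin n → ℝ, x' j = ξ → net.IsAdmissible lam j N x' u' →
      cost α β j N x u ≤ cost α β j N x' u'

/-- The state sequence that starts at time `j` in `ξ` and is driven by the static state feedback
`u k = φ k (x k)`. (The entries before time `j` are irrelevant and equal to `ξ`.) -/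
def trajectory (net : CTMNetwork n V) (lam : ℕ → Fin n → ℝ) (φ : ℕ → (Fin n → ℝ) → (Fin n → ℝ))
    (j : ℕ) (ξ : Fin n → ℝ) : ℕ → Fin n → ℝ
  | 0 => ξ
  | k + 1 =>
    if k + 1 ≤ j then ξ
    else net.step lam k (net.trajectory lam φ j ξ k) (φ k (net.trajectory lam φ j ξ k))

/-- Index set of the decision vector `z = (u^j, …, u^{N-1})` over the horizon `[j, N]`. -/
abbrev DecisionIndex (n j N : ℕ) : Type := ↥(Finset.Ico j N) × Fin n

/-- The control sequence `(u^j, …, u^{N-1})` with decision vector `z`, continued by zero. -/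
def controls {j N : ℕ} (z : DecisionIndex n j N → ℝ) : ℕ → Fin n → ℝ :=
  fun k i => if hk : k ∈ Finset.Ico j N then z (⟨k, hk⟩, i) else 0

/-- The multi-parametric linear program `P` is the optimal control problem over `[j, N]`, with
parameter `θ = x^j` and decision vector `z = (u^j, …, u^{N-1})`: a decision vector is feasible
in `P` exactly if the control sequence is admissible from `θ`, and the costs differ by a
function of `θ` only. -/
def IsLPForm (net : CTMNetwork n V) (lam α β : ℕ → Fin n → ℝ) (j N : ℕ)
    (P : MPLP (DecisionIndex n j N) (Fin n)) : Prop :=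
  (∀ θ z, z ∈ P.feasible θ ↔
    net.IsAdmissible lam j N (net.trajectory lam (fun k _ => controls z k) j θ) (controls z)) ∧
  ∃ g : (Fin n → ℝ) → ℝ, ∀ θ z,
    cost α β j N (net.trajectory lam (fun k _ => controls z k) j θ) (controls z)
      = P.c ⬝ᵥ z + g θ

/-- The piecewise affine data of the first control action `u^k` of a piecewise affine decision
vector `(u^k, …, u^{N-1})`: the rows of `F` and `f` that belong to time `k`, on the same
polyhedra. -/
def firstBlock {k N : ℕ} (hk : k < N) (A : PWAData (Fin n) (DecisionIndex n k N)) :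
    PWAData (Fin n) (Fin n) where
  count := A.count
  rows := A.rows
  H := A.H
  h := A.h
  F := fun i => (A.F i).submatrix (fun a => (⟨k, Finset.left_mem_Ico.2 hk⟩, a)) id
  f := fun i a => A.f i (⟨k, Finset.left_mem_Ico.2 hk⟩, a)

/-- The feedback laws that apply, at every time `k`, the first control action of the decision
vector `zs k x`. -/
def firstActions {N : ℕ} (zs : (k : ℕ) → (Fin n → ℝ) → (DecisionIndex n k N → ℝ)) :
    ℕ → (Fin n → ℝ) → (Fin n → ℝ) :=
  fun k x => controls (zs k x) k

end CTMNetwork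

end

/-! An open-loop trajectory is affine in the initial state and the controls together, and an upper
bound by a minimum of affine functions is a conjunction of affine inequalities. So admissibility is
a polyhedral condition on (state, decision vector) with an affine cost, which is an mp-LP
(`exists_isLPForm`). Its objective is bounded below because `0 ≤ u ≤ C`.

Optimizers need not be unique, so continuity must come from a choice. Fourier–Motzkin elimination
gives every polyhedral set-valued map a continuous selection taken from finitely many affine maps
(`IsPolyhedral.exists_selection`). For the program, add a parameter `r` and the constraint `c ⬝ z ≤
r`, and let `s (θ, r)` be such a selection. The least admissible `r` is the optimal value `t θ`,
itself a maximum of affine functions by one more elimination. Then `s (θ, t θ)` is a continuous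
optimizer (`MPLP.exists_isPWASolution`).

The polyhedral partition is cut out by the signs of the domain constraints and of the coordinate
differences of the candidate affine maps. On a sign cell, which is convex, no two candidates cross,
so a continuous selection is a single one of them (`IsAffineSelectionOn.exists_isContinuousPWAOn`).

Closed-loop optimality is backward induction (`isOptimal_trajectory_of_first`). The tail of an
open-loop optimum is admissible from the next state, and the feedback does at least as well there,
whichever optimizers were chosen. -/

/-! ### Polyhedral sets -/

section Polyhedral

variable {E F : Type*} [AddCommGroup E] [Module ℝ E] [AddCommGroup F] [Module ℝ F]

/-- A set is polyhedral if it is described by finitely many affine inequalities. -/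
def IsPolyhedral (P : Set E) : Prop :=
  ∃ S : Set (E →ᵃ[ℝ] ℝ), S.Finite ∧ P = {x | ∀ g ∈ S, g x ≤ 0}

theorem isPolyhedral_setOf_le (g h : E →ᵃ[ℝ] ℝ) : IsPolyhedral {x | g x ≤ h x} :=
  ⟨{g - h}, Set.finite_singleton _, by ext x; simp⟩

theorem IsPolyhedral.iInter {ι : Sort*} [Finite ι] {P : ι → Set E}
    (h : ∀ i, IsPolyhedral (P i)) : IsPolyhedral (⋂ i, P i) := by
  choose S hS hP using h
  refine ⟨⋃ i, S i, Set.finite_iUnion hS, ?_⟩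
  ext x
  simp only [hP, Set.mem_iInter, Set.mem_ofPred_eq, Set.mem_iUnion]
  exact ⟨fun H g ⟨i, hi⟩ => H i g hi, fun H i g hi => H g ⟨i, hi⟩⟩

theorem IsPolyhedral.setOf_forall {ι : Sort*} [Finite ι] {p : ι → E → Prop}
    (h : ∀ i, IsPolyhedral {x | p i x}) : IsPolyhedral {x | ∀ i, p i x} := by
  simpa only [Set.ofPred_forall] using IsPolyhedral.iInter h

theorem isPolyhedral_univ : IsPolyhedral (Set.univ : Set E) :=
  ⟨∅, Set.finite_empty, by simp⟩

theorem IsPolyhedral.setOf_imp {c : Prop} {p : E → Prop} (h : IsPolyhedral {x | p x}) :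
    IsPolyhedral {x | c → p x} := by
  by_cases hc : c
  · simpa [hc] using h
  · simpa [hc] using isPolyhedral_univ

theorem IsPolyhedral.inter {P Q : Set E} (hP : IsPolyhedral P) (hQ : IsPolyhedral Q) :
    IsPolyhedral (P ∩ Q) := by
  rw [Set.inter_eq_iInter]
  exact IsPolyhedral.iInter (by rintro (_ | _) <;> assumption)

theorem IsPolyhedral.preimage {P : Set F} (hP : IsPolyhedral P) (g : E →ᵃ[ℝ] F) :
    IsPolyhedral (g ⁻¹' P) := by
  obtain ⟨S, hS, rfl⟩ := hP
  refine ⟨(fun h => h.comp g) '' S, hS.image _, ?_⟩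
  ext x
  simp

/-- The inequalities of a polyhedral subset of `E × ℝ` are lower bounds for the last coordinate,
upper bounds for it, or do not involve it. -/
theorem IsPolyhedral.exists_bounds {P : Set (E × ℝ)} (hP : IsPolyhedral P) :
    ∃ S lo up : Set (E →ᵃ[ℝ] ℝ), S.Finite ∧ lo.Finite ∧ up.Finite ∧ ∀ x t, (x, t) ∈ P ↔
      (∀ g ∈ S, g x ≤ 0) ∧ (∀ g ∈ lo, g x ≤ t) ∧ ∀ g ∈ up, t ≤ g x := by
  obtain ⟨S, hS, rfl⟩ := hP
  -- `s g` is the slope of `g` in the last coordinate and `a g` its restriction to `t = 0`; solving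
  -- `g (x, t) ≤ 0` for `t` gives the bound `-(a g x) / s g`, whose direction depends on the sign of
  -- `s g`.
  let s : (E × ℝ →ᵃ[ℝ] ℝ) → ℝ := fun g => g.linear (0, 1)
  let a : (E × ℝ →ᵃ[ℝ] ℝ) → (E →ᵃ[ℝ] ℝ) := fun g => g.comp (LinearMap.inl ℝ E ℝ).toAffineMap
  have key : ∀ g : E × ℝ →ᵃ[ℝ] ℝ, ∀ x t, g (x, t) = a g x + t * s g := by
    intro g x t
    have h1 : ((x, t) : E × ℝ) = t • ((0 : E), (1 : ℝ)) +ᵥ (x, (0 : ℝ)) := by simp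
    rw [h1, g.map_vadd, map_smul]
    simp only [a, s, vadd_eq_add, smul_eq_mul]
    exact add_comm _ _
  refine ⟨a '' {g ∈ S | s g = 0}, (fun g => (-(s g)⁻¹) • a g) '' {g ∈ S | s g < 0},
    (fun g => (-(s g)⁻¹) • a g) '' {g ∈ S | 0 < s g}, (hS.subset (Set.sep_subset _ _)).image _,
    (hS.subset (Set.sep_subset _ _)).image _, (hS.subset (Set.sep_subset _ _)).image _, ?_⟩
  have neg : ∀ g x t, s g < 0 → ((-(s g)⁻¹) • a g x ≤ t ↔ g (x, t) ≤ 0) := by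
    intro g x t h
    have h2 : (-(s g)⁻¹) • a g x = a g x / (-s g) := by rw [smul_eq_mul]; field_simp
    rw [h2, key, div_le_iff₀ (by linarith)]
    constructor <;> intro h <;> linarith
  have pos : ∀ g x t, 0 < s g → (t ≤ (-(s g)⁻¹) • a g x ↔ g (x, t) ≤ 0) := by
    intro g x t h
    have h2 : (-(s g)⁻¹) • a g x = (- a g x) / s g := by rw [smul_eq_mul]; field_simp
    rw [h2, key, le_div_iff₀ h]
    constructor <;> intro h <;> linarith
  intro x t
  simp only [Set.mem_ofPred_eq, Set.forall_mem_image, and_imp]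
  constructor
  · intro H
    refine ⟨fun g hg h0 => ?_, fun g hg h0 => (neg g x t h0).2 (H g hg),
      fun g hg h0 => (pos g x t h0).2 (H g hg)⟩
    have := H g hg
    rwa [key, h0, mul_zero, add_zero] at this
  · rintro ⟨h0, hn, hp⟩ g hg
    rcases lt_trichotomy (s g) 0 with h | h | h
    · exact (neg g x t h).1 (hn hg h)
    · rw [key, h, mul_zero, add_zero]
      exact h0 hg h
    · exact (pos g x t h).1 (hp hg h)

end Polyhedral

/-! ### Continuous selections of finitely many affine maps -/

section Selection

variable {E F G : Type*} [NormedAddCommGroup E] [NormedSpace ℝ E]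
  [NormedAddCommGroup F] [NormedSpace ℝ F] [NormedAddCommGroup G] [NormedSpace ℝ G]

/-- `f` is continuous on `D` and coincides at every point of `D` with one of finitely many affine
maps. -/
def IsAffineSelectionOn (f : E → F) (D : Set E) : Prop :=
  ContinuousOn f D ∧ ∃ L : Set (E →ᵃ[ℝ] F), L.Finite ∧ ∀ x ∈ D, ∃ g ∈ L, f x = g x

theorem IsAffineSelectionOn.comp {f : E → F} {g : F → G} {D : Set E} {D' : Set F}
    (hg : IsAffineSelectionOn g D') (hf : IsAffineSelectionOn f D) (h : Set.MapsTo f D D') :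
    IsAffineSelectionOn (g ∘ f) D := by
  obtain ⟨hgc, M, hM, hgM⟩ := hg
  obtain ⟨hfc, L, hL, hfL⟩ := hf
  refine ⟨hgc.comp hfc h, Set.image2 (fun a b => a.comp b) M L, hM.image2 _ hL, fun x hx => ?_⟩
  obtain ⟨b, hb, hfb⟩ := hfL x hx
  obtain ⟨a, ha, hga⟩ := hgM _ (h hx)
  exact ⟨_, Set.mem_image2_of_mem ha hb, by simp [hga, ← hfb]⟩

theorem IsAffineSelectionOn.prodMk {f : E → F} {g : E → G} {D : Set E}
    (hf : IsAffineSelectionOn f D) (hg : IsAffineSelectionOn g D) :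
    IsAffineSelectionOn (fun x => (f x, g x)) D := by
  obtain ⟨hgc, M, hM, hgM⟩ := hg
  obtain ⟨hfc, L, hL, hfL⟩ := hf
  refine ⟨hfc.prodMk hgc, Set.image2 (fun a b => a.prod b) L M, hL.image2 _ hM, fun x hx => ?_⟩
  obtain ⟨b, hb, hfb⟩ := hfL x hx
  obtain ⟨a, ha, hga⟩ := hgM x hx
  exact ⟨_, Set.mem_image2_of_mem hb ha, by simp [hga, hfb]⟩

theorem AffineMap.isAffineSelectionOn [FiniteDimensional ℝ E] (g : E →ᵃ[ℝ] F) (D : Set E) : IsAffineSelectionOn g D :=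
  ⟨g.continuous_of_finiteDimensional.continuousOn, {g}, Set.finite_singleton _,
    fun _ _ => ⟨g, rfl, rfl⟩⟩

theorem IsAffineSelectionOn.affine_comp [FiniteDimensional ℝ F] {f : E → F} {D : Set E}
    (g : F →ᵃ[ℝ] G) (hf : IsAffineSelectionOn f D) : IsAffineSelectionOn (fun x => g (f x)) D :=
  (g.isAffineSelectionOn Set.univ).comp hf (Set.mapsTo_univ _ _)

variable [FiniteDimensional ℝ E]

theorem exists_isAffineSelectionOn_max {L : Set (E →ᵃ[ℝ] ℝ)} (hL : L.Finite)
    (hne : L.Nonempty) (D : Set E) : ∃ f : E → ℝ, IsAffineSelectionOn f D ∧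
      ∀ x, IsGreatest ((fun g : E →ᵃ[ℝ] ℝ => g x) '' L) (f x) := by
  lift L to Finset (E →ᵃ[ℝ] ℝ) using hL
  have hne' : L.Nonempty := hne
  have hmem : ∀ x, ∃ g ∈ L, L.sup' hne' (fun g : E →ᵃ[ℝ] ℝ => g x) = g x := fun x =>
    Finset.exists_mem_eq_sup' hne' _
  refine ⟨fun x => L.sup' hne' (fun g => g x), ⟨?_, L, L.finite_toSet, fun x _ => hmem x⟩,
    fun x => ⟨?_, ?_⟩⟩
  · exact (Continuous.finset_sup'_apply hne'
      fun g _ => g.continuous_of_finiteDimensional).continuousOn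
  · obtain ⟨g, hg, h⟩ := hmem x
    exact ⟨g, hg, h.symm⟩
  · rintro _ ⟨g, hg, rfl⟩
    exact Finset.le_sup' (fun g : E →ᵃ[ℝ] ℝ => g x) hg

theorem exists_isAffineSelectionOn_min {L : Set (E →ᵃ[ℝ] ℝ)} (hL : L.Finite)
    (hne : L.Nonempty) (D : Set E) : ∃ f : E → ℝ, IsAffineSelectionOn f D ∧
      ∀ x, IsLeast ((fun g : E →ᵃ[ℝ] ℝ => g x) '' L) (f x) := by
  obtain ⟨f, hf, hmax⟩ := exists_isAffineSelectionOn_max (hL.image Neg.neg) (hne.image _) D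
  refine ⟨_, ((-AffineMap.id ℝ ℝ).isAffineSelectionOn Set.univ).comp hf (Set.mapsTo_univ _ _),
    fun x => ?_⟩
  obtain ⟨⟨_, ⟨g, hg, rfl⟩, hgx⟩, hle⟩ := hmax x
  refine ⟨⟨g, hg, ?_⟩, ?_⟩
  · simp [← hgx]
  · rintro _ ⟨g', hg', rfl⟩
    have : (-g') x ≤ f x := hle ⟨-g', ⟨g', hg', rfl⟩, rfl⟩
    have h2 : -(g' x) ≤ f x := this
    change -(f x) ≤ g' x
    linarith

/-- Fourier–Motzkin elimination of one variable. The selection is the least one wherever the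
fibre is bounded below. -/
theorem IsPolyhedral.exists_selection_real {P : Set (E × ℝ)} (hP : IsPolyhedral P) :
    IsPolyhedral (Prod.fst '' P) ∧ ∃ f : E → ℝ, IsAffineSelectionOn f (Prod.fst '' P) ∧
      ∀ x ∈ Prod.fst '' P, (x, f x) ∈ P ∧
        (BddBelow {t | (x, t) ∈ P} → ∀ t, (x, t) ∈ P → f x ≤ t) := by
  obtain ⟨S, lo, up, hS, hlo, hup, h⟩ := hP.exists_bounds
  have hsel : ∃ f : E → ℝ, IsAffineSelectionOn f (Prod.fst '' P) ∧
      ∀ x, (∀ g ∈ S, g x ≤ 0) → (∀ l ∈ lo, ∀ u ∈ up, l x ≤ u x) → (x, f x) ∈ P ∧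
        (BddBelow {t | (x, t) ∈ P} → ∀ t, (x, t) ∈ P → f x ≤ t) := by
    rcases lo.eq_empty_or_nonempty with rfl | hne
    -- Without lower bounds a nonempty fibre extends to `-∞`, so minimality is vacuous and any point
    -- of the fibre will do.
    · have key : ∀ x s, (x, s) ∈ P → ¬ BddBelow {t | (x, t) ∈ P} := by
        rintro x s hs ⟨b, hb⟩
        have hs' := (h x s).1 hs
        have h1 : (x, min s (b - 1)) ∈ P := (h _ _).2 ⟨hs'.1, by simp,
          fun g hg => (min_le_left _ _).trans (hs'.2.2 g hg)⟩
        have h2 := hb h1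
        linarith [min_le_right s (b - 1)]
      rcases up.eq_empty_or_nonempty with rfl | hne'
      · refine ⟨fun _ => 0, (AffineMap.const ℝ E (0 : ℝ)).isAffineSelectionOn _, ?_⟩
        intro x hx _
        have hmem : (x, (0 : ℝ)) ∈ P := (h _ _).2 ⟨hx, by simp, by simp⟩
        exact ⟨hmem, fun hb => absurd hb (key _ _ hmem)⟩
      · obtain ⟨f, hf, hmin⟩ := exists_isAffineSelectionOn_min hup hne' (Prod.fst '' P)
        refine ⟨f, hf, fun x hx _ => ?_⟩
        have hmem : (x, f x) ∈ P :=
          (h _ _).2 ⟨hx, by simp, fun g hg => (hmin x).2 ⟨g, hg, rfl⟩⟩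
        exact ⟨hmem, fun hb => absurd hb (key _ _ hmem)⟩
    -- The largest lower bound is the least point of the fibre.
    · obtain ⟨f, hf, hmax⟩ := exists_isAffineSelectionOn_max hlo hne (Prod.fst '' P)
      refine ⟨f, hf, fun x hx hlu => ⟨(h _ _).2 ⟨hx, fun g hg => (hmax x).2 ⟨g, hg, rfl⟩, ?_⟩, ?_⟩⟩
      · intro u hu
        obtain ⟨l, hl, hlx⟩ := (hmax x).1
        exact hlx ▸ hlu l hl u hu
      · intro _ t ht
        obtain ⟨l, hl, hlx⟩ := (hmax x).1
        exact hlx ▸ ((h _ _).1 ht).2.1 l hl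
  obtain ⟨f, hf, hfP⟩ := hsel
  have hD : ∀ x, x ∈ Prod.fst '' P ↔
      (∀ g ∈ S, g x ≤ 0) ∧ ∀ l ∈ lo, ∀ u ∈ up, l x ≤ u x := by
    intro x
    constructor
    · rintro ⟨⟨x, t⟩, hxt, rfl⟩
      obtain ⟨h0, h1, h2⟩ := (h _ _).1 hxt
      exact ⟨h0, fun l hl u hu => (h1 l hl).trans (h2 u hu)⟩
    · rintro ⟨h0, h1⟩
      exact ⟨_, (hfP x h0 h1).1, rfl⟩
  refine ⟨?_, f, hf, fun x hx => hfP x ((hD x).1 hx).1 ((hD x).1 hx).2⟩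
  refine ⟨S ∪ Set.image2 (fun l u => l - u) lo up, hS.union (hlo.image2 _ hup), ?_⟩
  ext x
  rw [hD]
  simp only [Set.mem_ofPred_eq, Set.mem_union, or_imp, forall_and, Set.forall_mem_image2]
  simp

/-- Induction on the number of eliminated variables: the first one is moved into the base, the
remaining `m` are selected over `E × ℝ`, and then the first is selected over `E`. The space `E` is
quantified inside because it changes in the induction. -/
theorem IsPolyhedral.exists_selection_fin (m : ℕ) : ∀ {E : Type*} [NormedAddCommGroup E]
    [NormedSpace ℝ E] [FiniteDimensional ℝ E] {P : Set (E × (Fin m → ℝ))}, IsPolyhedral P →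
    IsPolyhedral (Prod.fst '' P) ∧ ∃ f : E → Fin m → ℝ, IsAffineSelectionOn f (Prod.fst '' P) ∧
      ∀ x ∈ Prod.fst '' P, (x, f x) ∈ P := by
  induction m with
  | zero =>
    intro E _ _ _ P hP
    let g : E →ᵃ[ℝ] E × (Fin 0 → ℝ) := (LinearMap.inl ℝ E (Fin 0 → ℝ)).toAffineMap
    have hD : Prod.fst '' P = g ⁻¹' P := by
      ext x
      constructor
      · rintro ⟨⟨x, z⟩, h, rfl⟩
        have : z = 0 := Subsingleton.elim _ _
        subst this
        exact h
      · exact fun h => ⟨_, h, rfl⟩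
    rw [hD]
    exact ⟨hP.preimage g, fun _ => 0, (AffineMap.const ℝ E _).isAffineSelectionOn _, fun x hx => hx⟩
  | succ m ih =>
    intro E _ _ _ P hP
    let e : (Fin m → ℝ) × ℝ →ₗ[ℝ] (Fin (m + 1) → ℝ) :=
      { toFun := fun p => Fin.cons p.2 p.1
        map_add' := fun p q => by
          ext i; refine Fin.cases ?_ (fun i => ?_) i <;> simp
        map_smul' := fun c p => by
          ext i; refine Fin.cases ?_ (fun i => ?_) i <;> simp }
    let L : (E × ℝ) × (Fin m → ℝ) →ₗ[ℝ] E × (Fin (m + 1) → ℝ) :=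
      LinearMap.prod (LinearMap.fst ℝ E ℝ ∘ₗ LinearMap.fst ℝ (E × ℝ) (Fin m → ℝ))
        (e ∘ₗ LinearMap.prod (LinearMap.snd ℝ (E × ℝ) (Fin m → ℝ))
          (LinearMap.snd ℝ E ℝ ∘ₗ LinearMap.fst ℝ (E × ℝ) (Fin m → ℝ)))
    have hL : ∀ x t z, L ((x, t), z) = (x, Fin.cons t z) := fun _ _ _ => rfl
    obtain ⟨h1, f, hf, hfP⟩ := ih (hP.preimage L.toAffineMap)
    obtain ⟨h2, t, ht, htP⟩ := h1.exists_selection_real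
    have hD : Prod.fst '' (Prod.fst '' (L.toAffineMap ⁻¹' P)) = Prod.fst '' P := by
      ext x
      constructor
      · rintro ⟨_, ⟨⟨⟨x, s⟩, z⟩, h, rfl⟩, rfl⟩
        exact ⟨_, h, rfl⟩
      · rintro ⟨⟨x, z⟩, h, rfl⟩
        refine ⟨_, ⟨((x, z 0), Fin.tail z), ?_, rfl⟩, rfl⟩
        change L ((x, z 0), Fin.tail z) ∈ P
        rwa [hL, Fin.cons_self_tail]
    rw [hD] at h2 ht htP
    have hpair : IsAffineSelectionOn (fun x => (x, t x)) (Prod.fst '' P) :=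
      ((AffineMap.id ℝ E).isAffineSelectionOn _).prodMk ht
    refine ⟨h2, fun x => Fin.cons (t x) (f (x, t x)), ?_, fun x hx => ?_⟩
    · exact ((hf.comp hpair fun x hx => (htP x hx).1).prodMk ht).affine_comp e.toAffineMap
    · exact hfP _ (htP x hx).1

/-- A polyhedral set-valued map has a polyhedral domain and a continuous piecewise affine
selection. -/
theorem IsPolyhedral.exists_selection {κ : Type*} [Fintype κ] {P : Set (E × (κ → ℝ))}
    (hP : IsPolyhedral P) : IsPolyhedral (Prod.fst '' P) ∧
      ∃ f : E → κ → ℝ, IsAffineSelectionOn f (Prod.fst '' P) ∧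
        ∀ x ∈ Prod.fst '' P, (x, f x) ∈ P := by
  let e : (Fin (Fintype.card κ) → ℝ) ≃ₗ[ℝ] (κ → ℝ) :=
    LinearEquiv.funCongrLeft ℝ ℝ (Fintype.equivFin κ)
  let L : E × (Fin (Fintype.card κ) → ℝ) →ₗ[ℝ] E × (κ → ℝ) :=
    LinearMap.prodMap LinearMap.id e.toLinearMap
  have hD : Prod.fst '' (L.toAffineMap ⁻¹' P) = Prod.fst '' P := by
    ext x
    constructor
    · rintro ⟨⟨x, z⟩, h, rfl⟩
      exact ⟨_, h, rfl⟩
    · rintro ⟨⟨x, z⟩, h, rfl⟩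
      refine ⟨(x, e.symm z), ?_, rfl⟩
      change (x, e (e.symm z)) ∈ P
      rwa [e.apply_symm_apply]
  obtain ⟨h1, f, hf, hfP⟩ := IsPolyhedral.exists_selection_fin _ (hP.preimage L.toAffineMap)
  rw [hD] at h1 hf hfP
  exact ⟨h1, fun x => e (f x), hf.affine_comp e.toLinearMap.toAffineMap, hfP⟩

end Selection

/-! ### Partition by the signs of finitely many affine functions -/

section SignPartition

variable {E F : Type*} [NormedAddCommGroup E] [NormedSpace ℝ E]
  [NormedAddCommGroup F] [NormedSpace ℝ F]

/-- The points at which all functions in `T` have the same sign as at `p`. -/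
def signCell (T : Set (E →ᵃ[ℝ] ℝ)) (p : E) : Set E :=
  {x | ∀ g ∈ T, SignType.sign (g x) = SignType.sign (g p)}

/-- The points at which all functions in `T` have weakly the same sign as at `p`. -/
def signRegion (T : Set (E →ᵃ[ℝ] ℝ)) (p : E) : Set E :=
  {x | ∀ g ∈ T, (g p ≤ 0 → g x ≤ 0) ∧ (0 ≤ g p → 0 ≤ g x)}

theorem self_mem_signCell (T : Set (E →ᵃ[ℝ] ℝ)) (p : E) : p ∈ signCell T p := fun _ _ => rfl

theorem signCell_subset_signRegion (T : Set (E →ᵃ[ℝ] ℝ)) (p : E) :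
    signCell T p ⊆ signRegion T p := by
  intro x hx g hg
  have h := hx g hg
  constructor
  · intro h0
    rw [← sign_nonpos_iff] at h0 ⊢
    rwa [h]
  · intro h0
    rw [← sign_nonneg_iff] at h0 ⊢
    rwa [h]

theorem isPolyhedral_signRegion {T : Set (E →ᵃ[ℝ] ℝ)} (hT : T.Finite) (p : E) :
    IsPolyhedral (signRegion T p) := by
  have := hT.to_subtype
  have h : signRegion T p =
      {x | ∀ g : T, x ∈ {x | g.1 p ≤ 0 → g.1 x ≤ 0} ∩ {x | 0 ≤ g.1 p → 0 ≤ g.1 x}} := by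
    ext x
    exact ⟨fun h g => h g.1 g.2, fun h g hg => h ⟨g, hg⟩⟩
  rw [h]
  refine IsPolyhedral.setOf_forall fun g => IsPolyhedral.inter ?_ ?_
  · exact IsPolyhedral.setOf_imp (by simpa using isPolyhedral_setOf_le g.1 (AffineMap.const ℝ E 0))
  · exact IsPolyhedral.setOf_imp (by simpa using isPolyhedral_setOf_le (AffineMap.const ℝ E 0) g.1)

/-- Each sign condition is the affine preimage of an order-connected subset of `ℝ`. Convexity
supplies the connectedness used to single out one affine map. -/
theorem convex_signCell (T : Set (E →ᵃ[ℝ] ℝ)) (p : E) : Convex ℝ (signCell T p) := by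
  have h : signCell T p =
      ⋂ g ∈ T, g ⁻¹' ((SignType.sign : ℝ →o SignType) ⁻¹' {SignType.sign (g p)}) := by
    ext x
    simp [signCell]
  rw [h]
  exact convex_iInter₂ fun g _ => Convex.affine_preimage g
    (Set.ordConnected_singleton.preimage_mono SignType.sign.monotone).convex

/-- On the open segment from `p` to `x`, each `g` is a combination of `g p`, with positive weight,
and `g x`, whose sign weakly agrees; so it keeps the sign of `g p`. -/
theorem signRegion_subset_closure_signCell (T : Set (E →ᵃ[ℝ] ℝ)) (p : E) :
    signRegion T p ⊆ closure (signCell T p) := by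
  intro x hx
  have h : openSegment ℝ p x ⊆ signCell T p := by
    rintro _ ⟨a, b, ha, hb, hab, rfl⟩ g hg
    have hgv : g (a • p + b • x) = a * g p + b * g x := by
      have h1 : a • p + b • x = AffineMap.lineMap p x b := by
        rw [AffineMap.lineMap_apply_module, ← hab, add_sub_cancel_right]
      rw [h1, AffineMap.apply_lineMap, AffineMap.lineMap_apply_module, ← hab,
        add_sub_cancel_right]
      rfl
    obtain ⟨h1, h2⟩ := hx g hg
    rw [hgv]
    rcases lt_trichotomy (g p) 0 with h0 | h0 | h0
    · rw [sign_neg h0, sign_neg]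
      have := mul_neg_of_pos_of_neg ha h0
      have := mul_nonpos_of_nonneg_of_nonpos hb.le (h1 h0.le)
      linarith
    · rw [h0, le_antisymm (h1 h0.le) (h2 h0.ge)]
      simp
    · rw [sign_pos h0, sign_pos]
      have := mul_pos ha h0
      have := mul_nonneg hb.le (h2 h0.le)
      linarith
  exact closure_mono h (segment_subset_closure_openSegment (right_mem_segment ℝ p x))

/-- From a relative interior point `y` one can continue the line from `p` slightly beyond `y` inside
the region. If `g y = 0` and `g p ≠ 0`, then `g` would have the forbidden sign there. -/
theorem intrinsicInterior_signRegion_subset (T : Set (E →ᵃ[ℝ] ℝ)) (p : E) :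
    intrinsicInterior ℝ (signRegion T p) ⊆ signCell T p := by
  intro x hx
  have hxR := intrinsicInterior_subset hx
  obtain ⟨y, hy, rfl⟩ := mem_intrinsicInterior.1 hx
  have hp : p ∈ affineSpan ℝ (signRegion T p) :=
    subset_affineSpan _ _ (signCell_subset_signRegion T p (self_mem_signCell T p))
  -- The line is taken inside the affine span, where the relative interior is an ordinary interior.
  let l : ℝ → affineSpan ℝ (signRegion T p) := fun t =>
    ⟨AffineMap.lineMap p y.1 t, AffineMap.lineMap_mem t hp y.2⟩
  have hl : Continuous l := AffineMap.lineMap_continuous.subtype_mk _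
  have hl1 : l 1 = y := by ext; simp [l]
  have hnear : ∀ᶠ t in nhds (1 : ℝ), (l t : E) ∈ signRegion T p := by
    have h := mem_interior_iff_mem_nhds.1 hy
    rw [← hl1] at h
    exact hl.continuousAt.eventually h
  obtain ⟨t, ht, ht1⟩ := ((hnear.filter_mono nhdsWithin_le_nhds).and
    (self_mem_nhdsWithin : Set.Ioi (1 : ℝ) ∈ nhdsWithin 1 (Set.Ioi 1))).exists
  intro g hg
  obtain ⟨h1, h2⟩ := hxR g hg
  obtain ⟨h3, h4⟩ := ht g hg
  have hgv : g (l t) = (1 - t) * g p + t * g y := by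
    change g (AffineMap.lineMap p y.1 t) = _
    rw [AffineMap.apply_lineMap, AffineMap.lineMap_apply_module, smul_eq_mul, smul_eq_mul]
  rw [hgv] at h3 h4
  have ht1' : 1 < t := ht1
  rcases lt_trichotomy (g p) 0 with h0 | h0 | h0
  · rw [sign_neg h0, sign_neg]
    have := mul_pos_of_neg_of_neg (show 1 - t < 0 by linarith) h0
    refine (h1 h0.le).lt_of_ne fun h => ?_
    have := h3 h0.le
    rw [h] at this
    linarith
  · rw [h0, le_antisymm (h1 h0.le) (h2 h0.ge)]
  · rw [sign_pos h0, sign_pos]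
    have := mul_neg_of_neg_of_pos (show 1 - t < 0 by linarith) h0
    refine (h2 h0.le).lt_of_ne fun h => ?_
    have := h4 h0.le
    rw [← h] at this
    linarith

/-- A continuous selection of finitely many maps that do not cross on a preconnected set is one of
them. -/
theorem IsPreconnected.exists_eqOn_of_selection {X Y : Type*} [TopologicalSpace X]
    [TopologicalSpace Y] [T2Space Y] {C : Set X} (hC : IsPreconnected C) {p : X} (hp : p ∈ C)
    {L : Set (X → Y)} (hL : L.Finite) {f : X → Y} (hf : ContinuousOn f C)
    (hLc : ∀ g ∈ L, ContinuousOn g C) (hsel : ∀ x ∈ C, ∃ g ∈ L, f x = g x)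
    (hcross : ∀ g ∈ L, ∀ g' ∈ L, ∀ x ∈ C, g x = g' x → g p = g' p)
    (hcross' : ∀ g ∈ L, ∀ g' ∈ L, ∀ x ∈ C, g p = g' p → g x = g' x) :
    ∃ g ∈ L, Set.EqOn f g C := by
  obtain ⟨g, hg, hfg⟩ := hsel p hp
  refine ⟨g, hg, ?_⟩
  have : PreconnectedSpace C := Subtype.preconnectedSpace hC
  have hcl : ∀ g ∈ L, IsClosed {x : C | f x = g x} := fun g hg =>
    isClosed_eq hf.domRestrict (hLc g hg).domRestrict
  -- The agreement set is closed; its complement is a finite union of agreement sets with the maps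
  -- that differ from `g` at `p`, hence closed too.
  have hcompl : {x : C | f x = g x}ᶜ = ⋃ g' ∈ {g' ∈ L | g' p ≠ g p}, {x : C | f x = g' x} := by
    ext x
    simp only [Set.mem_compl_iff, Set.mem_ofPred_eq, Set.mem_iUnion, exists_prop]
    constructor
    · intro h
      obtain ⟨g', hg', hx⟩ := hsel x x.2
      exact ⟨g', ⟨hg', fun h' => h (hx.trans (hcross' g' hg' g hg x x.2 h'))⟩, hx⟩
    · rintro ⟨g', ⟨hg', hne⟩, hx⟩ h
      exact hne (hcross g' hg' g hg x x.2 (hx.symm.trans h))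
  have hclopen : IsClopen {x : C | f x = g x} := by
    refine ⟨hcl g hg, ?_⟩
    rw [← isClosed_compl_iff, hcompl]
    exact (hL.subset (Set.sep_subset _ _)).isClosed_biUnion fun g' hg' => hcl g' hg'.1
  rcases isClopen_iff.1 hclopen with h | h
  · exact absurd (show (⟨p, hp⟩ : C) ∈ {x : C | f x = g x} from hfg) (by rw [h]; simp)
  · intro x hx
    exact (show (⟨x, hx⟩ : C) ∈ {x : C | f x = g x} by rw [h]; trivial)

end SignPartition

/-! ### Piecewise affine data -/

section PWA

variable {ι κ : Type*} [Fintype ι]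

theorem AffineMap.exists_mulVec_add (g : (ι → ℝ) →ᵃ[ℝ] (κ → ℝ)) :
    ∃ (M : Matrix κ ι ℝ) (b : κ → ℝ), ∀ x, g x = M.mulVec x + b := by
  classical
  refine ⟨LinearMap.toMatrix' g.linear, g 0, fun x => ?_⟩
  rw [LinearMap.toMatrix'_mulVec, g.decomp']
  simp

theorem IsPolyhedral.exists_rows {E : Type*} [AddCommGroup E] [Module ℝ E] {P : Set E}
    (hP : IsPolyhedral P) : ∃ (r : ℕ) (g : Fin r → E →ᵃ[ℝ] ℝ), P = {x | ∀ i, g i x ≤ 0} := by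
  obtain ⟨S, hS, rfl⟩ := hP
  have := hS.fintype
  refine ⟨Fintype.card S, fun i => ((Fintype.equivFin S).symm i).1, ?_⟩
  ext x
  simp only [Set.mem_ofPred_eq]
  rw [(Fintype.equivFin S).symm.forall_congr_left]
  simp

theorem IsPolyhedral.exists_mulVec_le {P : Set (ι → ℝ)} (hP : IsPolyhedral P) :
    ∃ (r : ℕ) (H : Matrix (Fin r) ι ℝ) (h : Fin r → ℝ), P = {x | H.mulVec x ≤ h} := by
  obtain ⟨r, g, rfl⟩ := hP.exists_rows
  obtain ⟨M, b, hM⟩ := AffineMap.exists_mulVec_add (AffineMap.pi g)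
  refine ⟨r, M, -b, ?_⟩
  ext x
  have h : ∀ i, g i x = (M.mulVec x + b) i := fun i => congrFun (hM x) i
  simp only [Set.mem_ofPred_eq, h, Pi.le_def, Pi.add_apply, Pi.neg_apply]
  exact forall_congr' fun i => by constructor <;> intro h <;> linarith

theorem IsAffineSelectionOn.exists_isContinuousPWAOn [Fintype κ] {D : Set (ι → ℝ)} (hD : IsPolyhedral D)
    {f : (ι → ℝ) → κ → ℝ} (hf : IsAffineSelectionOn f D) :
    ∃ A : PWAData ι κ, IsContinuousPWAOn A D f := by
  classical
  obtain ⟨S, hS, rfl⟩ := hD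
  obtain ⟨hfc, L, hL, hfL⟩ := hf
  let D : Set (ι → ℝ) := {x | ∀ g ∈ S, g x ≤ 0}
  -- The constraints `S` keep each region inside the domain; the coordinate differences keep
  -- candidates from crossing within a cell.
  let T : Set ((ι → ℝ) →ᵃ[ℝ] ℝ) := S ∪ ⋃ j : κ, Set.image2
    (fun g g' => (LinearMap.proj j : (κ → ℝ) →ₗ[ℝ] ℝ).toAffineMap.comp (g - g')) L L
  have hT : T.Finite := hS.union (Set.finite_iUnion fun j => hL.image2 _ hL)
  have hcross : ∀ g ∈ L, ∀ g' ∈ L, ∀ p, ∀ x ∈ signCell T p, (g x = g' x ↔ g p = g' p) := by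
    intro g hg g' hg' p x hx
    simp only [funext_iff]
    refine forall_congr' fun j => ?_
    have h := hx _ (Or.inr (Set.mem_iUnion.2 ⟨j, Set.mem_image2_of_mem hg hg'⟩))
    rw [← sub_eq_zero (a := g x j), ← sign_eq_zero_iff (a := g x j - g' x j),
      ← sub_eq_zero (a := g p j), ← sign_eq_zero_iff (a := g p j - g' p j)]
    exact Eq.congr_left h
  have hsub : ∀ p ∈ D, signRegion T p ⊆ D := fun p hp x hx g hg =>
    (hx g (Or.inl hg)).1 (hp g hg)
  have haff : ∀ p ∈ D, ∃ g ∈ L, Set.EqOn f g (signRegion T p) := by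
    intro p hp
    have hCR := signCell_subset_signRegion T p
    have hc : ∀ g : (ι → ℝ) →ᵃ[ℝ] (κ → ℝ), Continuous g := fun g =>
      g.continuous_of_finiteDimensional
    obtain ⟨_, ⟨g, hg, rfl⟩, hfg⟩ :=
      (convex_signCell T p).isPreconnected.exists_eqOn_of_selection (self_mem_signCell T p)
      (L := (fun g : (ι → ℝ) →ᵃ[ℝ] (κ → ℝ) => (g : (ι → ℝ) → κ → ℝ)) '' L) (hL.image _)
      (hfc.mono (hCR.trans (hsub p hp)))
      (by rintro _ ⟨g, hg, rfl⟩; exact (hc g).continuousOn)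
      (fun x hx => by
        obtain ⟨g, hg, h⟩ := hfL x (hsub p hp (hCR hx))
        exact ⟨_, ⟨g, hg, rfl⟩, h⟩)
      (by rintro _ ⟨g, hg, rfl⟩ _ ⟨g', hg', rfl⟩ x hx; exact (hcross g hg g' hg' p x hx).1)
      (by rintro _ ⟨g, hg, rfl⟩ _ ⟨g', hg', rfl⟩ x hx; exact (hcross g hg g' hg' p x hx).2)
    exact ⟨g, hg, hfg.of_subset_closure (hfc.mono (hsub p hp)) (hc g).continuousOn hCR
      (signRegion_subset_closure_signCell T p)⟩
  have := hT.to_subtype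
  -- One region per sign vector attained on the domain. There are finitely many, and distinct ones
  -- give disjoint cells.
  let sgn : (ι → ℝ) → T → SignType := fun x g => SignType.sign (g.1 x)
  have hcell : ∀ x p, sgn x = sgn p ↔ x ∈ signCell T p := fun x p => by
    simp [sgn, funext_iff, signCell]
  have : Finite (sgn '' D) := Set.toFinite _
  have := Fintype.ofFinite (sgn '' D)
  let e := Fintype.equivFin (sgn '' D)
  have hrep : ∀ i : Fin (Fintype.card (sgn '' D)), ∃ p ∈ D, sgn p = (e.symm i).1 :=
    fun i => (e.symm i).2
  choose p hpD hp using hrep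
  choose r H h hH using fun i => (isPolyhedral_signRegion hT (p i)).exists_mulVec_le
  choose g hg hfg using fun i => haff (p i) (hpD i)
  choose M b hM using fun i => (g i).exists_mulVec_add
  let A : PWAData ι κ := ⟨_, r, H, h, M, b⟩
  have hreg : ∀ i, A.region i = signRegion T (p i) := fun i => (hH i).symm
  refine ⟨A, ⟨fun i => ?_, ?_, fun i j hij => ?_, fun i x hx => ?_, hfc⟩⟩
  · rw [hreg]
    exact ⟨p i, signCell_subset_signRegion T _ (self_mem_signCell T _)⟩
  · refine Set.Subset.antisymm (Set.iUnion_subset fun i => ?_) fun x hx => ?_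
    · rw [hreg]
      exact hsub _ (hpD i)
    · refine Set.mem_iUnion.2 ⟨e ⟨sgn x, x, hx, rfl⟩, ?_⟩
      rw [hreg]
      refine signCell_subset_signRegion T _ ((hcell _ _).1 ?_)
      rw [hp]
      simp
  · rw [hreg, hreg, Set.disjoint_left]
    intro x hi hj
    have hi' := (hcell _ _).2 (intrinsicInterior_signRegion_subset T _ hi)
    have hj' := (hcell _ _).2 (intrinsicInterior_signRegion_subset T _ hj)
    refine hij (e.symm.injective (Subtype.ext ?_))
    rw [← hp, ← hp, ← hi', ← hj']
  · rw [hreg] at hx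
    rw [hfg i hx]
    exact hM i x

end PWA

/-! ### Multi-parametric linear programs -/

namespace MPLP

variable {κ ι : Type*} [Fintype κ] [Fintype ι]

theorem isPolyhedral_feasible (P : MPLP κ ι) :
    IsPolyhedral {p : (ι → ℝ) × (κ → ℝ) | p.2 ∈ P.feasible p.1} := by
  classical
  refine IsPolyhedral.setOf_forall fun i => ?_
  let W : (ι → ℝ) × (κ → ℝ) →ₗ[ℝ] ℝ :=
    LinearMap.proj i ∘ₗ Matrix.mulVecLin P.W ∘ₗ LinearMap.snd ℝ _ _
  let S : (ι → ℝ) × (κ → ℝ) →ₗ[ℝ] ℝ :=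
    LinearMap.proj i ∘ₗ Matrix.mulVecLin P.S ∘ₗ LinearMap.fst ℝ _ _
  exact isPolyhedral_setOf_le W.toAffineMap (AffineMap.const ℝ _ (P.G i) + S.toAffineMap)

/-- A multi-parametric linear program whose objective is bounded below on every feasible set has a
continuous piecewise affine optimizer. -/
theorem exists_isPWASolution (P : MPLP κ ι)
    (hb : ∀ θ, BddBelow ((fun z => P.c ⬝ᵥ z) '' P.feasible θ)) :
    ∃ A zs, P.IsPWASolution A zs := by
  let Q : Set (((ι → ℝ) × ℝ) × (κ → ℝ)) :=
    {p | p.2 ∈ P.feasible p.1.1} ∩ {p | P.c ⬝ᵥ p.2 ≤ p.1.2}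
  have hQ : IsPolyhedral Q := by
    refine IsPolyhedral.inter ?_ ?_
    · exact P.isPolyhedral_feasible.preimage
        (LinearMap.prodMap (LinearMap.fst ℝ (ι → ℝ) ℝ)
          (LinearMap.id : (κ → ℝ) →ₗ[ℝ] (κ → ℝ))).toAffineMap
    · let c : ((ι → ℝ) × ℝ) × (κ → ℝ) →ₗ[ℝ] ℝ :=
        (dotProductBilin ℝ ℝ P.c) ∘ₗ LinearMap.snd ℝ ((ι → ℝ) × ℝ) (κ → ℝ)
      let t : ((ι → ℝ) × ℝ) × (κ → ℝ) →ₗ[ℝ] ℝ :=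
        LinearMap.snd ℝ (ι → ℝ) ℝ ∘ₗ LinearMap.fst ℝ ((ι → ℝ) × ℝ) (κ → ℝ)
      exact isPolyhedral_setOf_le c.toAffineMap t.toAffineMap
  obtain ⟨h1, s, hs, hsQ⟩ := hQ.exists_selection
  obtain ⟨h2, t, ht, htQ⟩ := h1.exists_selection_real
  have hmem : ∀ θ r, (θ, r) ∈ Prod.fst '' Q ↔ ∃ z ∈ P.feasible θ, P.c ⬝ᵥ z ≤ r := by
    intro θ r
    constructor
    · rintro ⟨⟨_, z⟩, hz, rfl⟩
      exact ⟨z, hz⟩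
    · rintro ⟨z, hz⟩
      exact ⟨((θ, r), z), hz, rfl⟩
  have hD : Prod.fst '' (Prod.fst '' Q) = P.feasibleParams := by
    ext θ
    constructor
    · rintro ⟨⟨θ, r⟩, h, rfl⟩
      obtain ⟨z, hz, -⟩ := (hmem _ _).1 h
      exact ⟨z, hz⟩
    · rintro ⟨z, hz⟩
      exact ⟨(θ, P.c ⬝ᵥ z), (hmem _ _).2 ⟨z, hz, le_rfl⟩, rfl⟩
  rw [hD] at h2 ht htQ
  have hzs : IsAffineSelectionOn (fun θ => s (θ, t θ)) P.feasibleParams :=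
    hs.comp (((AffineMap.id ℝ (ι → ℝ)).isAffineSelectionOn _).prodMk ht)
      fun θ hθ => (htQ θ hθ).1
  obtain ⟨A, hA⟩ := hzs.exists_isContinuousPWAOn h2
  refine ⟨A, _, fun θ hθ => ?_, hA⟩
  have hθQ := hsQ _ (htQ θ hθ).1
  refine ⟨hθQ.1, fun z' hz' => le_trans hθQ.2 ?_⟩
  -- Here boundedness is needed: `t θ` is the least admissible level only if the levels are bounded
  -- below.
  refine (htQ θ hθ).2 ?_ _ ((hmem _ _).2 ⟨z', hz', le_rfl⟩)
  obtain ⟨b, hb⟩ := hb θ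
  refine ⟨b, fun r hr => ?_⟩
  obtain ⟨z, hz, hzr⟩ := (hmem _ _).1 hr
  exact (hb ⟨z, hz, rfl⟩).trans hzr

/-- A polyhedral constraint set together with an objective that is affine in parameter and decision
vector is a multi-parametric linear program. -/
theorem exists_of_isPolyhedral {Q : Set ((ι → ℝ) × (κ → ℝ))} (hQ : IsPolyhedral Q)
    (J : (ι → ℝ) × (κ → ℝ) →ᵃ[ℝ] ℝ) :
    ∃ P : MPLP κ ι, (∀ θ z, z ∈ P.feasible θ ↔ (θ, z) ∈ Q) ∧
      ∀ θ z, J (θ, z) = P.c ⬝ᵥ z + J (θ, 0) := by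
  classical
  obtain ⟨r, g, rfl⟩ := hQ.exists_rows
  have hJ : ∀ θ z, J (θ, z) = J.linear (0, z) + J (θ, 0) := by
    intro θ z
    rw [← vadd_eq_add, ← J.map_vadd]
    simp
  let a : (ι → ℝ) × (κ → ℝ) →ᵃ[ℝ] (Fin r → ℝ) := AffineMap.pi g
  have ha : ∀ θ z, a (θ, z) = a.linear (0, z) + (a.linear (θ, 0) + a 0) := by
    intro θ z
    rw [← add_assoc, ← map_add, ← vadd_eq_add, ← a.map_vadd]
    simp
  -- Each affine row splits into its `z`-part `W`, its `θ`-part `-S` and its constant `-G`.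
  refine ⟨⟨r, fun i => J.linear (0, Pi.single i 1),
    LinearMap.toMatrix' (a.linear ∘ₗ LinearMap.inr ℝ (ι → ℝ) (κ → ℝ)), -a 0,
    -LinearMap.toMatrix' (a.linear ∘ₗ LinearMap.inl ℝ (ι → ℝ) (κ → ℝ))⟩, fun θ z => ?_,
    fun θ z => ?_⟩
  · have h : (θ, z) ∈ {x | ∀ i, g i x ≤ 0} ↔ a (θ, z) ≤ 0 := Iff.rfl
    rw [h, ha θ z]
    simp only [feasible, Set.mem_ofPred_eq, Matrix.neg_mulVec, LinearMap.toMatrix'_mulVec]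
    change a.linear (0, z) ≤ -a 0 + -a.linear (θ, 0) ↔ _
    rw [← neg_add_rev, le_neg_iff_add_nonpos_right]
  · rw [hJ]
    congr 1
    have h := LinearMap.pi_apply_eq_sum_univ (J.linear ∘ₗ LinearMap.inr ℝ (ι → ℝ) (κ → ℝ)) z
    refine Eq.trans h (Finset.sum_congr rfl fun i _ => ?_)
    have hi : (fun j => if i = j then (1 : ℝ) else 0) = Pi.single i 1 := by
      ext j
      simp [Pi.single_apply, eq_comm]
    rw [smul_eq_mul, mul_comm, hi]
    rfl

end MPLP

/-! ### The optimal control problem as a multi-parametric linear program -/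

namespace CTMNetwork

variable {n : ℕ} {V : Type*}

/-- The control at time `k` as a linear function of the decision vector. -/
def controlsLinear (n j N k : ℕ) : (DecisionIndex n j N → ℝ) →ₗ[ℝ] (Fin n → ℝ) where
  toFun z := controls z k
  map_add' z z' := by
    ext i
    by_cases hk : k ∈ Finset.Ico j N <;> simp [controls, hk]
  map_smul' c z := by
    ext i
    by_cases hk : k ∈ Finset.Ico j N <;> simp [controls, hk]

theorem exists_inflow_affine (net : CTMNetwork n V) (lam : ℕ → Fin n → ℝ) (k : ℕ) :
    ∃ g : (Fin n → ℝ) →ᵃ[ℝ] (Fin n → ℝ), ∀ u, net.inflow lam k u = g u := by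
  refine ⟨AffineMap.const ℝ _ (lam k) +
    (Matrix.mulVecLin (Matrix.of (net.R k)).transpose).toAffineMap, fun u => ?_⟩
  ext i
  simp [inflow, Matrix.vecMul, dotProduct, mul_comm]

/-- The controls are fixed in advance rather than fed back from the state, so every step composes
affine maps. -/
theorem exists_trajectory_affine (net : CTMNetwork n V) (lam : ℕ → Fin n → ℝ) (j N k : ℕ) :
    ∃ g : (Fin n → ℝ) × (DecisionIndex n j N → ℝ) →ᵃ[ℝ] (Fin n → ℝ),
      ∀ p, net.trajectory lam (fun k _ => controls p.2 k) j p.1 k = g p := by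
  induction k with
  | zero => exact ⟨(LinearMap.fst ℝ _ _).toAffineMap, fun _ => rfl⟩
  | succ k ih =>
    by_cases hk : k + 1 ≤ j
    · exact ⟨(LinearMap.fst ℝ _ _).toAffineMap, fun p => by simp [trajectory, hk]⟩
    · obtain ⟨g, hg⟩ := ih
      obtain ⟨y, hy⟩ := net.exists_inflow_affine lam k
      let u : (Fin n → ℝ) × (DecisionIndex n j N → ℝ) →ᵃ[ℝ] (Fin n → ℝ) :=
        (controlsLinear n j N k ∘ₗ LinearMap.snd ℝ _ _).toAffineMap
      refine ⟨g + net.Ts • (y.comp u - u), fun p => ?_⟩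
      ext i
      simp only [trajectory, if_neg hk, step, hg, hy]
      rfl

theorem trajectory_of_le (net : CTMNetwork n V) (lam : ℕ → Fin n → ℝ)
    (φ : ℕ → (Fin n → ℝ) → (Fin n → ℝ)) {j k : ℕ} (ξ : Fin n → ℝ) (hk : k ≤ j) :
    net.trajectory lam φ j ξ k = ξ := by
  cases k with
  | zero => rfl
  | succ k => rw [trajectory, if_pos hk]

theorem trajectory_succ (net : CTMNetwork n V) (lam : ℕ → Fin n → ℝ)
    (φ : ℕ → (Fin n → ℝ) → (Fin n → ℝ)) {j k : ℕ} (ξ : Fin n → ℝ) (hk : j ≤ k) :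
    net.trajectory lam φ j ξ (k + 1) =
      net.step lam k (net.trajectory lam φ j ξ k) (φ k (net.trajectory lam φ j ξ k)) := by
  rw [trajectory, if_neg (by omega)]

theorem isPolyhedral_le_demand (net : CTMNetwork n V) {E : Type*} [AddCommGroup E] [Module ℝ E]
    (i : Fin n) (g ξ : E →ᵃ[ℝ] ℝ) : IsPolyhedral {p | g p ≤ net.demand i (ξ p)} := by
  simp only [demand, le_min_iff]
  exact (isPolyhedral_setOf_le g ((net.v i / net.len i) • ξ)).inter
    (isPolyhedral_setOf_le g (AffineMap.const ℝ E (net.C i)))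

theorem isPolyhedral_le_supply (net : CTMNetwork n V) {E : Type*} [AddCommGroup E] [Module ℝ E]
    (i : Fin n) (g ξ : E →ᵃ[ℝ] ℝ) : IsPolyhedral {p | g p ≤ net.supply i (ξ p)} := by
  rcases h : net.γ i with _ | γ
  · simp only [supply, h]
    exact isPolyhedral_setOf_le g (AffineMap.const ℝ E (net.C i))
  · simp only [supply, h, le_min_iff]
    exact (isPolyhedral_setOf_le g
      (net.w i • (AffineMap.const ℝ E γ - (1 / net.len i) • ξ))).inter
      (isPolyhedral_setOf_le g (AffineMap.const ℝ E (net.C i)))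

theorem isPolyhedral_isAdmissible (net : CTMNetwork n V) (lam : ℕ → Fin n → ℝ) (j N : ℕ) :
    IsPolyhedral {p : (Fin n → ℝ) × (DecisionIndex n j N → ℝ) | net.IsAdmissible lam j N
      (net.trajectory lam (fun k _ => controls p.2 k) j p.1) (controls p.2)} := by
  let pr : Fin n → (Fin n → ℝ) →ᵃ[ℝ] ℝ := fun i =>
    (LinearMap.proj i : (Fin n → ℝ) →ₗ[ℝ] ℝ).toAffineMap
  choose x hx using net.exists_trajectory_affine lam j N
  choose y hy using net.exists_inflow_affine lam
  let u : ℕ → (Fin n → ℝ) × (DecisionIndex n j N → ℝ) →ᵃ[ℝ] (Fin n → ℝ) := fun k =>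
    (controlsLinear n j N k ∘ₗ LinearMap.snd ℝ _ _).toAffineMap
  -- The dynamics hold by construction of the trajectory, so only the demand and supply inequalities
  -- remain.
  have hset : {p : (Fin n → ℝ) × (DecisionIndex n j N → ℝ) | net.IsAdmissible lam j N
      (net.trajectory lam (fun k _ => controls p.2 k) j p.1) (controls p.2)} =
      {p | ∀ k : Finset.Ico j N, p ∈ {p | ∀ i, p ∈
        ({p | (0 : ℝ) ≤ u k p i} ∩ {p | u k p i ≤ net.demand i (x k p i)}) ∩
        ({p | (0 : ℝ) ≤ y k (u k p) i} ∩ {p | y k (u k p) i ≤ net.supply i (x k p i)})}} := by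
    ext p
    simp only [IsAdmissible, hy, hx]
    constructor
    · rintro h ⟨k, hk⟩
      rw [Finset.mem_Ico] at hk
      exact (h k hk.1 hk.2).2
    · intro h k hjk hkN
      refine ⟨?_, h ⟨k, Finset.mem_Ico.2 ⟨hjk, hkN⟩⟩⟩
      rw [← hx, ← hx]
      exact net.trajectory_succ lam _ _ hjk
  rw [hset]
  refine IsPolyhedral.setOf_forall fun k => IsPolyhedral.setOf_forall fun i =>
    IsPolyhedral.inter (IsPolyhedral.inter ?_ ?_) (IsPolyhedral.inter ?_ ?_)
  · exact isPolyhedral_setOf_le (AffineMap.const ℝ _ 0) ((pr i).comp (u k))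
  · exact net.isPolyhedral_le_demand i ((pr i).comp (u k)) ((pr i).comp (x k))
  · exact isPolyhedral_setOf_le (AffineMap.const ℝ _ 0) ((pr i).comp ((y k).comp (u k)))
  · exact net.isPolyhedral_le_supply i ((pr i).comp ((y k).comp (u k))) ((pr i).comp (x k))

theorem exists_cost_affine (net : CTMNetwork n V) (lam α β : ℕ → Fin n → ℝ) (j N : ℕ) :
    ∃ J : (Fin n → ℝ) × (DecisionIndex n j N → ℝ) →ᵃ[ℝ] ℝ, ∀ θ z,
      cost α β j N (net.trajectory lam (fun k _ => controls z k) j θ) (controls z) = J (θ, z) := by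
  let lin : (Fin n → ℝ) → (Fin n → ℝ) →ᵃ[ℝ] ℝ := fun a =>
    (dotProductBilin ℝ ℝ a : (Fin n → ℝ) →ₗ[ℝ] ℝ).toAffineMap
  choose x hx using net.exists_trajectory_affine lam j N
  let u : ℕ → (Fin n → ℝ) × (DecisionIndex n j N → ℝ) →ᵃ[ℝ] (Fin n → ℝ) := fun k =>
    (controlsLinear n j N k ∘ₗ LinearMap.snd ℝ _ _).toAffineMap
  have hsum : ∀ (s : Finset ℕ) (f : ℕ → (Fin n → ℝ) × (DecisionIndex n j N → ℝ) →ᵃ[ℝ] ℝ) p,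
      (∑ k ∈ s, f k) p = ∑ k ∈ s, f k p := by
    intro s f p
    induction s using Finset.cons_induction with
    | empty => rfl
    | cons a s ha ih => rw [Finset.sum_cons, Finset.sum_cons, ← ih]; rfl
  refine ⟨(lin (α N)).comp (x N) +
    ∑ k ∈ Finset.Ico j N, ((lin (α k)).comp (x k) + (lin (β k)).comp (u k)), fun θ z => ?_⟩
  have hx' : ∀ k, net.trajectory lam (fun k _ => controls z k) j θ k = x k (θ, z) :=
    fun k => hx k (θ, z)
  rw [AffineMap.coe_add, Pi.add_apply, hsum]
  simp only [cost, hx', Finset.sum_add_distrib (s := (Finset.univ : Finset (Fin n)))]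
  rfl

theorem exists_isLPForm (net : CTMNetwork n V) (lam α β : ℕ → Fin n → ℝ) (j N : ℕ) :
    ∃ P, net.IsLPForm lam α β j N P := by
  obtain ⟨J, hJ⟩ := net.exists_cost_affine lam α β j N
  obtain ⟨P, hP, hPJ⟩ := MPLP.exists_of_isPolyhedral (net.isPolyhedral_isAdmissible lam j N) J
  exact ⟨P, hP, fun θ => J (θ, 0), fun θ z => (hJ θ z).trans (hPJ θ z)⟩

/-- The demand constraint confines every coordinate of `z` to `[0, C i]`, whatever the state is. -/
theorem IsLPForm.bddBelow {net : CTMNetwork n V} {lam α β : ℕ → Fin n → ℝ} {j N : ℕ}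
    {P : MPLP (DecisionIndex n j N) (Fin n)} (hP : net.IsLPForm lam α β j N P) (θ : Fin n → ℝ) :
    BddBelow ((fun z => P.c ⬝ᵥ z) '' P.feasible θ) := by
  refine ⟨∑ a, -(|P.c a| * net.C a.2), ?_⟩
  rintro _ ⟨z, hz, rfl⟩
  refine Finset.sum_le_sum ?_
  rintro ⟨⟨k, hk⟩, i⟩ -
  obtain ⟨⟨h0, h1⟩, -⟩ :=
    (((hP.1 θ z).1 hz) k (Finset.mem_Ico.1 hk).1 (Finset.mem_Ico.1 hk).2).2 i
  have h2 := h1.trans (min_le_right _ _)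
  have hz : controls z k i = z (⟨k, hk⟩, i) := dif_pos hk
  rw [hz] at h0 h2
  calc -(|P.c (⟨k, hk⟩, i)| * net.C i) ≤ -(|P.c (⟨k, hk⟩, i)| * z (⟨k, hk⟩, i)) := by gcongr
    _ ≤ P.c (⟨k, hk⟩, i) * z (⟨k, hk⟩, i) := by
      rw [← neg_mul]
      gcongr
      exact neg_abs_le _

/-! ### Closed-loop optimality -/

theorem IsAdmissible.congr {net : CTMNetwork n V} {lam : ℕ → Fin n → ℝ} {j N : ℕ}
    {x u x' u' : ℕ → Fin n → ℝ} (h : net.IsAdmissible lam j N x u)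
    (hx : ∀ k, j ≤ k → k ≤ N → x' k = x k) (hu : ∀ k, j ≤ k → k < N → u' k = u k) :
    net.IsAdmissible lam j N x' u' := by
  intro k hjk hkN
  rw [hx k hjk hkN.le, hx (k + 1) (by omega) hkN, hu k hjk hkN]
  exact h k hjk hkN

theorem cost_congr (α β : ℕ → Fin n → ℝ) {j N : ℕ} (hjN : j ≤ N) {x u x' u' : ℕ → Fin n → ℝ}
    (hx : ∀ k, j ≤ k → k ≤ N → x' k = x k) (hu : ∀ k, j ≤ k → k < N → u' k = u k) :
    cost α β j N x' u' = cost α β j N x u := by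
  unfold cost
  rw [hx N hjN le_rfl]
  congr 1
  refine Finset.sum_congr rfl fun k hk => ?_
  obtain ⟨h1, h2⟩ := Finset.mem_Ico.1 hk
  rw [hx k h1 h2.le, hu k h1 h2]

theorem cost_eq_add (α β : ℕ → Fin n → ℝ) {j N : ℕ} (hj : j < N) (x u : ℕ → Fin n → ℝ) :
    cost α β j N x u =
      ∑ i, (α j i * x j i + β j i * u j i) + cost α β (j + 1) N x u := by
  unfold cost
  rw [Finset.sum_eq_sum_Ico_succ_bot hj]
  ring

theorem IsAdmissible.tail {net : CTMNetwork n V} {lam : ℕ → Fin n → ℝ} {j N : ℕ}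
    {x u : ℕ → Fin n → ℝ} (h : net.IsAdmissible lam j N x u) :
    net.IsAdmissible lam (j + 1) N x u :=
  fun k hk hkN => h k (by omega) hkN

/-- Uniqueness of solutions of the recursion. It identifies admissible state sequences with
trajectories of their decision vectors, and allows a closed loop to be restarted at a later time. -/
theorem trajectory_eq_of_step (net : CTMNetwork n V) {lam : ℕ → Fin n → ℝ} {j N : ℕ}
    {φ : ℕ → (Fin n → ℝ) → (Fin n → ℝ)} {x : ℕ → Fin n → ℝ}
    (h : ∀ k, j ≤ k → k < N → x (k + 1) = net.step lam k (x k) (φ k (x k))) :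
    ∀ k, j ≤ k → k ≤ N → net.trajectory lam φ j (x j) k = x k := by
  intro k hjk
  induction k, hjk using Nat.le_induction with
  | base => exact fun _ => net.trajectory_of_le lam φ _ le_rfl
  | succ k hjk ih =>
    intro hkN
    rw [net.trajectory_succ lam φ _ hjk, ih (by omega), h k hjk hkN]

/-- The decision vector of a control sequence. -/
def decision (j N : ℕ) (u : ℕ → Fin n → ℝ) : DecisionIndex n j N → ℝ := fun a => u a.1 a.2

theorem controls_decision {j N : ℕ} (u : ℕ → Fin n → ℝ) {k : ℕ} (hjk : j ≤ k) (hkN : k < N) :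
    controls (decision j N u) k = u k := by
  ext i
  simp [controls, decision, hjk, hkN]

theorem trajectory_decision {net : CTMNetwork n V} {lam : ℕ → Fin n → ℝ} {j N : ℕ}
    {x u : ℕ → Fin n → ℝ} (h : net.IsAdmissible lam j N x u) {k : ℕ} (hjk : j ≤ k) (hkN : k ≤ N) :
    net.trajectory lam (fun k _ => controls (decision j N u) k) j (x j) k = x k :=
  net.trajectory_eq_of_step (fun k hjk hkN => by
    rw [controls_decision u hjk hkN]
    exact (h k hjk hkN).1) k hjk hkN

theorem IsLPForm.decision_mem_feasible {net : CTMNetwork n V} {lam α β : ℕ → Fin n → ℝ} {j N : ℕ}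
    {P : MPLP (DecisionIndex n j N) (Fin n)} (hP : net.IsLPForm lam α β j N P)
    {x u : ℕ → Fin n → ℝ} (h : net.IsAdmissible lam j N x u) :
    decision j N u ∈ P.feasible (x j) :=
  (hP.1 _ _).2 (h.congr (fun _ hjk hkN => trajectory_decision h hjk hkN)
    fun _ hjk hkN => controls_decision u hjk hkN)

theorem IsLPForm.feasibleParams_eq {net : CTMNetwork n V} {lam α β : ℕ → Fin n → ℝ} {j N : ℕ}
    {P : MPLP (DecisionIndex n j N) (Fin n)} (hP : net.IsLPForm lam α β j N P) :
    P.feasibleParams = net.feasibleStates lam j N := by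
  ext ξ
  constructor
  · rintro ⟨z, hz⟩
    exact ⟨_, _, net.trajectory_of_le lam _ ξ le_rfl, (hP.1 _ _).1 hz⟩
  · rintro ⟨x, u, rfl, h⟩
    exact ⟨_, hP.decision_mem_feasible h⟩

/-- An optimizer of the linear program is an optimal control sequence. -/
theorem IsLPForm.isOptimal {net : CTMNetwork n V} {lam α β : ℕ → Fin n → ℝ} {j N : ℕ}
    (hjN : j ≤ N) {P : MPLP (DecisionIndex n j N) (Fin n)} (hP : net.IsLPForm lam α β j N P)
    {ξ : Fin n → ℝ} {z : DecisionIndex n j N → ℝ} (hz : P.IsOptimizer ξ z) :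
    net.IsOptimal lam α β j N ξ (net.trajectory lam (fun k _ => controls z k) j ξ)
      (controls z) := by
  refine ⟨⟨net.trajectory_of_le lam _ ξ le_rfl, (hP.1 _ _).1 hz.1⟩, ?_⟩
  rintro x u rfl h
  obtain ⟨g, hg⟩ := hP.2
  have h1 := hz.2 _ (hP.decision_mem_feasible h)
  have h2 := hg (x j) (decision j N u)
  rw [cost_congr α β hjN (fun _ hjk hkN => trajectory_decision h hjk hkN)
    fun _ hjk hkN => controls_decision u hjk hkN] at h2
  rw [hg, h2]
  linarith

/-- The principle of optimality: a feedback law that always applies the first control of an optimal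
control sequence is optimal. -/
theorem isOptimal_trajectory_of_first (net : CTMNetwork n V) (lam α β : ℕ → Fin n → ℝ) (N : ℕ)
    (φ : ℕ → (Fin n → ℝ) → (Fin n → ℝ))
    (hφ : ∀ j < N, ∀ ξ ∈ net.feasibleStates lam j N, ∃ x u,
      net.IsOptimal lam α β j N ξ x u ∧ u j = φ j ξ) {j : ℕ} (hj : j ≤ N) :
    ∀ ξ ∈ net.feasibleStates lam j N, net.IsOptimal lam α β j N ξ (net.trajectory lam φ j ξ)
      (fun k => φ k (net.trajectory lam φ j ξ k)) := by
  induction hj using Nat.decreasingInduction with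
  | self =>
    intro ξ _
    have h0 := net.trajectory_of_le lam φ ξ (le_refl N)
    refine ⟨⟨h0, fun k h1 h2 => by omega⟩, fun x u hx _ => ?_⟩
    simp [cost, h0, hx]
  | of_succ j hj ih =>
    intro ξ hξ
    obtain ⟨x, u, ⟨⟨hx, hadm⟩, hopt⟩, hu⟩ := hφ j hj ξ hξ
    have h0 := net.trajectory_of_le lam φ ξ (le_refl j)
    obtain ⟨hstep, hcon⟩ := hadm j le_rfl hj
    rw [hx, hu] at hstep hcon
    have h1 : net.trajectory lam φ j ξ (j + 1) = x (j + 1) := by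
      rw [net.trajectory_succ lam φ ξ le_rfl, h0, hstep]
    obtain ⟨⟨-, hadm'⟩, hopt'⟩ := ih (x (j + 1)) ⟨x, u, rfl, hadm.tail⟩
    -- From time `j + 1` on, the closed loop is the one started afresh at the state that the
    -- open-loop optimum reaches, since both apply the same first control.
    have htraj : ∀ k, j + 1 ≤ k → k ≤ N →
        net.trajectory lam φ j ξ k = net.trajectory lam φ (j + 1) (x (j + 1)) k := by
      intro k hk hkN
      rw [← h1]
      exact (net.trajectory_eq_of_step (x := net.trajectory lam φ j ξ) (fun k hk _ =>
        net.trajectory_succ lam φ ξ (by omega)) k hk hkN).symm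
    have hctrl : ∀ k, j + 1 ≤ k → k < N → φ k (net.trajectory lam φ j ξ k) =
        φ k (net.trajectory lam φ (j + 1) (x (j + 1)) k) := fun k hk hkN => by
      rw [htraj k hk hkN.le]
    refine ⟨⟨h0, fun k hjk hkN => ?_⟩, fun x' u' hx' hadm'' => ?_⟩
    · rcases hjk.eq_or_lt with rfl | hlt
      · simp only [h0, h1]
        exact ⟨hstep, hcon⟩
      · exact hadm'.congr htraj hctrl k hlt hkN
    · refine le_trans ?_ (hopt x' u' hx' hadm'')
      -- The stage costs at `j` coincide; the induction hypothesis compares the tails.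
      rw [cost_eq_add α β hj, cost_eq_add α β hj, cost_congr α β hj htraj hctrl, h0, hx, hu]
      exact add_le_add le_rfl (hopt' x u rfl hadm.tail)

theorem firstActions_apply {N : ℕ}
    (zs : (k : ℕ) → (Fin n → ℝ) → (DecisionIndex n k N → ℝ)) {k : ℕ} (hk : k < N)
    (x : Fin n → ℝ) (i : Fin n) :
    firstActions zs k x i = zs k x (⟨k, Finset.left_mem_Ico.2 hk⟩, i) :=
  dif_pos (Finset.left_mem_Ico.2 hk)

theorem isContinuousPWAOn_firstBlock {N : ℕ}
    {zs : (k : ℕ) → (Fin n → ℝ) → (DecisionIndex n k N → ℝ)} {k : ℕ} (hk : k < N)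
    {A : PWAData (Fin n) (DecisionIndex n k N)} {D : Set (Fin n → ℝ)}
    (h : IsContinuousPWAOn A D (zs k)) :
    IsContinuousPWAOn (firstBlock hk A) D (firstActions zs k) where
  region_nonempty := h.region_nonempty
  iUnion_region := h.iUnion_region
  disjoint_interior := h.disjoint_interior
  eq_affine i x hx := by
    ext a
    rw [firstActions_apply zs hk, h.eq_affine i x hx]
    rfl
  continuousOn := by
    refine continuousOn_pi.2 fun i => ?_
    simp only [firstActions_apply zs hk]
    exact continuousOn_pi.1 h.continuousOn _

end CTMNetwork

theorem mainTheorem1 {n : ℕ} {V : Type*} (net : CTMNetwork n V) (N : ℕ)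
    (α β lam : ℕ → Fin n → ℝ)
    (hlam : ∀ k, ∀ i ∉ net.onRamps, lam k i = 0) :
    -- multi-parametric linear programs, one for each time `k < N`, independent of the states
    ∃ P : (k : ℕ) → MPLP (CTMNetwork.DecisionIndex n k N) (Fin n),
      (∀ k < N, net.IsLPForm lam α β k N (P k)) ∧
      -- each of them has a continuous piecewise affine solution
      (∀ k < N, ∃ A zs, (P k).IsPWASolution A zs) ∧
      -- the first control actions of any such solutions are optimal feedback laws
      ∀ (A : (k : ℕ) → PWAData (Fin n) (CTMNetwork.DecisionIndex n k N))
        (zs : (k : ℕ) → (Fin n → ℝ) → (CTMNetwork.DecisionIndex n k N → ℝ)),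
        (∀ k < N, (P k).IsPWASolution (A k) (zs k)) →
        (∀ (k : ℕ) (hk : k < N),
          IsContinuousPWAOn (CTMNetwork.firstBlock hk (A k)) (net.feasibleStates lam k N)
            (CTMNetwork.firstActions zs k)) ∧
        (∀ j < N, ∀ ξ ∈ net.feasibleStates lam j N,
          net.IsOptimal lam α β j N ξ
            (net.trajectory lam (CTMNetwork.firstActions zs) j ξ)
            (fun k => CTMNetwork.firstActions zs k
              (net.trajectory lam (CTMNetwork.firstActions zs) j ξ k))) := by
  choose P hP using fun k => net.exists_isLPForm lam α β k N
  refine ⟨P, fun k _ => hP k, fun k _ => (P k).exists_isPWASolution (hP k).bddBelow,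
    fun A zs h => ⟨fun k hk => ?_, fun j hj => ?_⟩⟩
  · rw [← (hP k).feasibleParams_eq]
    exact CTMNetwork.isContinuousPWAOn_firstBlock hk (h k hk).isContinuousPWAOn
  · refine net.isOptimal_trajectory_of_first lam α β N _ (fun k hk ξ hξ => ?_) hj.le
    rw [← (hP k).feasibleParams_eq] at hξ
    -- The feedback value is by definition the first control of the open-loop optimum given by `zs k
    -- ξ`.
    exact ⟨_, _, (hP k).isOptimal hk.le ((h k hk).isOptimizer ξ hξ), rfl⟩
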